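/- A signed graph $(G,\Sigma)$ is a finite loopless multigraph $G=(V,E)$ together with a set $\Sigma\subseteq E$ of odd edges (the other edges are even). Resigning on $S\subseteq V$ replaces $\Sigma$ by $\Sigma\,\Delta\,\delta(S)$, where $\delta(S)$ is the set of edges between $S$ and $V\setminus S$. Contracting an edge identifies its two ends and deletes all edges between them; the other edges keep their signs. $(G,\Sigma)$ is a splitting of $(H,\Sigma_H)$ if $(H,\Sigma_H)$ can be obtained from $(G,\Sigma)$ by a (possibly empty) sequence of resignings and contractions of even edges. For $c\in[-1,1]^E$, ${\rm P}(G,\Sigma,c)$ is the problem of finding a positive semidefinite matrix $X\in\mathbb{R}^{V\times V}$ with $X[i,i]=1$ for all $i\in V$, $X[i,j]\ge c(e)$ for every even edge $e=ij$ and $X[i,j]\le c(e)$ for every odd edge $e=ij$; $\mathcal{E}(G,\Sigma)$ is the set of all $c\in[-1,1]^E$ for which it is feasible. For $\omega\in\mathbb{R}^{V\cup E}$ let $\Omega=\sum_{i\in V}\omega(i)E_{ii}+\sum_{e=ij\in E}\omega(e)E_{ij}$ with $E_{ij}=(\boldsymbol e_i\boldsymbol e_j^\top+\boldsymbol e_j\boldsymbol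 e_i^\top)/2$. For $c\in\mathcal{E}(G,\Sigma)$ the singularity degree ${\sf sd}(G,\Sigma,c)$ is the smallest $k\ge 0$ for which there are $\omega^1,\dots,\omega^k\in\mathbb{R}^{V\cup E}$ with the following properties, where $\mathcal{V}^j=\{x\in\mathbb{R}^V : x^\top\Omega^i x=0\ (i=1,\dots,j)\}$: - $\omega^j(e)\le 0$ for even $e$ and $\omega^j(e)\ge 0$ for odd $e$, for every $j$; - $x^\top\Omega^j x\ge 0$ for all $x\in\mathcal{V}^{j-1}$, for every $j$; - $\sum_{i\in V}\omega^j(i)+\sum_{e\in E}\omega^j(e)c(e)\le 0$ for every $j$; - $\dim\mathcal{V}^k$ equals the maximum rank of a feasible solution of ${\rm P}(G,\Sigma,c)$. Such a $c$ is nondegenerate if $c(e)\ne 1$ for every even edge $e$ and $c(e)\neq -1$ for every odd edge $e$. Let ${\sf sd}(G,\Sigma)$ be the maximum of ${\sf sd}(G,\Sigma,c)$ over all $c\in\mathcal{E}(G,\Sigma)$, and ${\sf sd}^*(G,\Sigma)$ the maximum over all nondegenerate $c\in\mathcal{E}(G,\Sigma)$. (All these quantities take values in $\mathbb{N}\cup\{\infty\}$,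 with suprema in place of maxima and $\infty$ for the minimum of the empty set.) Lemma. For every signed graph $(G,\Sigma)$, $$ {\sf sd}(G,\Sigma)\le\max\left\{{\sf sd}^*(H,\Sigma_H)+1 : (G,\Sigma)\text{ is a splitting of }(H,\Sigma_H)\right\}, $$ where the maximum on the right is attained. -/

import Mathlib

/-- A (finite) signed graph: a multigraph, possibly with parallel edges but without loops, together
with a set `odd` of edges (written `Σ` in the literature). The edges in `odd` are called odd, the
other edges are called even. The vertices and the edges are taken from the types `α` and `β`, which
are finite in all that follows. -/
structure SignedGraph (α β : Type*) extends Graph α β where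
  loopless : toGraph.Loopless
  odd : Set β
  odd_subset : odd ⊆ edgeSet

namespace SignedGraph

variable {α β : Type*}

/-- The vertices of `G`, as a type. -/
abbrev Vert (G : SignedGraph α β) : Type _ := {v : α // v ∈ G.vertexSet}

/-- The edges of `G`, as a type. -/
abbrev Edge (G : SignedGraph α β) : Type _ := {e : β // e ∈ G.edgeSet}

/-! ### Resigning, contraction, splitting -/

/-- The cut `δ(S)`: the edges with one end in `S` and the other end outside of `S`. -/
def cut (G : SignedGraph α β) (S : Set α) : Set β :=
  {e | ∃ x y, G.IsLink e x y ∧ x ∈ S ∧ y ∉ S}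

/-- Resigning on `S` replaces the set of odd edges by its symmetric difference with `δ(S)`. -/
def resign (G : SignedGraph α β) (S : Set α) : SignedGraph α β where
  toGraph := G.toGraph
  loopless := G.loopless
  odd := symmDiff G.odd (G.cut S)
  odd_subset := by
    rintro e (⟨h, -⟩ | ⟨⟨x, y, h, -, -⟩, -⟩)
    · exact G.odd_subset h
    · exact h.edge_mem

open Classical in
/-- The contraction of an edge between `u` and `v`: the vertex `v` is identified with `u`, and all
edges between `u` and `v` (which would become loops) are deleted. All other edges keep their
sign. -/
noncomputable def contract (G : SignedGraph α β) (u v : α) : SignedGraph α β where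
  toGraph := (G.toGraph.deleteEdges {f | G.IsLink f u v}).map (fun x => if x = v then u else x)
  loopless := by
    refine ⟨fun f x hf => ?_⟩
    obtain ⟨a, b, hab, ha, hb⟩ := hf
    obtain ⟨h1, h2⟩ : G.IsLink f a b ∧ f ∉ {f | G.IsLink f u v} := by
      rwa [Graph.deleteEdges_isLink] at hab
    have hne : a ≠ b := G.loopless.not_isLoopAt f |> fun h hab => h b (by subst hab; exact h1)
    have h3 : ¬ G.IsLink f u v := h2
    have h4 : G.IsLink f b a := h1.symm
    dsimp only at ha hb
    split_ifs at ha hb <;> subst_vars <;> contradiction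
  odd := G.odd \ {f | G.IsLink f u v}
  odd_subset := by
    rintro f ⟨hf, hf'⟩
    exact ⟨G.odd_subset hf, hf'⟩

/-- `H` arises from `G` by one resigning or by the contraction of one even edge. -/
inductive Step (G : SignedGraph α β) : SignedGraph α β → Prop
  | resign (S : Set α) : Step G (G.resign S)
  | contract (e : β) (u v : α) (he : G.IsLink e u v) (heven : e ∉ G.odd) : Step G (G.contract u v)

/-- `G` is a splitting of `H`: `H` can be obtained from `G` by a (possibly empty) sequence of
resignings and contractions of even edges. -/
def IsSplitting (G H : SignedGraph α β) : Prop := Relation.ReflTransGen Step G H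

/-! ### The completion problem -/

section Completion

variable [Fintype α] [Fintype β]

open Classical in
/-- `X` is a feasible solution of the completion problem `P(G, Σ, c)`. -/
def IsFeasible (G : SignedGraph α β) (c : G.Edge → ℝ) (X : Matrix G.Vert G.Vert ℝ) : Prop :=
  X.PosSemidef ∧ (∀ v, X v v = 1) ∧
    ∀ (e : G.Edge) (x y : G.Vert), G.IsLink e x y →
      if (e : β) ∈ G.odd then X x y ≤ c e else c e ≤ X x y

/-- The set `𝓔(G, Σ)` of all `c ∈ [-1, 1]^E` for which `P(G, Σ, c)` is feasible. -/
def feasibleWeights (G : SignedGraph α β) : Set (G.Edge → ℝ) :=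
  {c | (∀ e, c e ∈ Set.Icc (-1 : ℝ) 1) ∧ ∃ X, G.IsFeasible c X}

/-- `c` is nondegenerate: `c e ≠ 1` on even edges and `c e ≠ -1` on odd edges. -/
def IsNondegenerate (G : SignedGraph α β) (c : G.Edge → ℝ) : Prop :=
  ∀ e : G.Edge, ((e : β) ∉ G.odd → c e ≠ 1) ∧ ((e : β) ∈ G.odd → c e ≠ -1)

open Classical in
/-- The matrix `E_{xy} = (e_x e_yᵀ + e_y e_xᵀ) / 2` of an edge with (distinct) ends `x`, `y`. -/
noncomputable def edgeMatrix (G : SignedGraph α β) (e : G.Edge) : Matrix G.Vert G.Vert ℝ :=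
  Matrix.of fun x y => if G.IsLink e x y then 1 / 2 else 0

open Classical in
/-- The symmetric matrix `Ω = ∑ v, ω(v) E_{vv} + ∑ e, ω(e) E_e` of a stress `ω ∈ ℝ^(V ∪ E)`. -/
noncomputable def stressMatrix (G : SignedGraph α β) (ω : G.Vert ⊕ G.Edge → ℝ) :
    Matrix G.Vert G.Vert ℝ :=
  Matrix.diagonal (fun v => ω (Sum.inl v)) + ∑ e : G.Edge, ω (Sum.inr e) • G.edgeMatrix e

/-- `ω` is properly signed: `ω ≤ 0` on even edges and `ω ≥ 0` on odd edges. These are the sign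
constraints of the dual of `P(G, Σ, c)`. -/
def IsProperlySigned (G : SignedGraph α β) (ω : G.Vert ⊕ G.Edge → ℝ) : Prop :=
  ∀ e : G.Edge, ((e : β) ∉ G.odd → ω (Sum.inr e) ≤ 0) ∧ ((e : β) ∈ G.odd → 0 ≤ ω (Sum.inr e))

open Classical in
/-- The objective function `∑ v, ω(v) + ∑ e, ω(e) c(e)` of the dual of `P(G, Σ, c)`. -/
noncomputable def dualValue (G : SignedGraph α β) (c : G.Edge → ℝ)
    (ω : G.Vert ⊕ G.Edge → ℝ) : ℝ :=
  ∑ v, ω (Sum.inl v) + ∑ e, ω (Sum.inr e) * c e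

end Completion

/-! ### Nested positive semidefinite sequences -/

section Nested

variable {n : Type*} [Fintype n] {k : ℕ}

/-- `𝓥^j = {x | xᵀ Y^i x = 0 for the first j matrices Y^i}`. -/
def nullSet (Y : Fin k → Matrix n n ℝ) (j : ℕ) : Set (n → ℝ) :=
  {x | ∀ i : Fin k, (i : ℕ) < j → x ⬝ᵥ (Y i).mulVec x = 0}

/-- The sequence `Y` is nested PSD: each matrix is positive semidefinite on the space `𝓥`
determined by its predecessors. -/
def IsNestedPSD (Y : Fin k → Matrix n n ℝ) : Prop :=
  ∀ i : Fin k, ∀ x ∈ nullSet Y i, 0 ≤ x ⬝ᵥ (Y i).mulVec x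

end Nested

/-! ### Singularity degree -/

section SingularityDegree

variable [Fintype α] [Fintype β]

open Classical in
/-- There is a sequence of `k` stresses that are properly signed, whose matrices are nested PSD,
whose dual values are nonpositive, and whose rank `|V| - dim 𝓥^k` equals `|V| - s`. Here `s` is the
maximum rank of a feasible solution of `P(G, Σ, c)`, which is the rank of each (relative) interior
point of the feasible set. -/
def HasFacialReduction (G : SignedGraph α β) (c : G.Edge → ℝ) (k : ℕ) : Prop :=
  ∃ ω : Fin k → G.Vert ⊕ G.Edge → ℝ,
    (∀ j, G.IsProperlySigned (ω j)) ∧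
    IsNestedPSD (fun j => G.stressMatrix (ω j)) ∧
    (∀ j, G.dualValue c (ω j) ≤ 0) ∧
    ∃ X, G.IsFeasible c X ∧ (∀ X', G.IsFeasible c X' → X'.rank ≤ X.rank) ∧
      Set.finrank ℝ (nullSet (fun j => G.stressMatrix (ω j)) k) = X.rank

/-- The singularity degree `sd(G, Σ, c)`: the smallest length of a sequence as above. The empty
sequence qualifies if and only if there is a positive definite feasible solution. -/
noncomputable def sdAt (G : SignedGraph α β) (c : G.Edge → ℝ) : ℕ∞ :=
  ⨅ k ∈ {k : ℕ | G.HasFacialReduction c k}, (k : ℕ∞)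

/-- The singularity degree `sd(G, Σ)`. -/
noncomputable def sd (G : SignedGraph α β) : ℕ∞ :=
  ⨆ c ∈ G.feasibleWeights, G.sdAt c

/-- The nondegenerate singularity degree `sd*(G, Σ)`. -/
noncomputable def sdNondeg (G : SignedGraph α β) : ℕ∞ :=
  ⨆ c ∈ {c | c ∈ G.feasibleWeights ∧ G.IsNondegenerate c}, G.sdAt c

end SingularityDegree

end SignedGraph

/-! An edge is degenerate at `c` if its bound is `1` (even) or `-1` (odd). Then the Gram vectors
of its ends agree up to the sign of the edge in every feasible solution. Resigning makes such an
edge even and contracting it loses nothing: the feasible solutions before and after correspond.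
Repeating this until no degenerate edge is left shows that `G` is a splitting of some `H` that
carries a corresponding nondegenerate `c'`.

The sum of the forms `(x a ∓ x b) ^ 2` over the degenerate edges `ab` of `G` is a single properly
signed stress with dual value `0`, and its kernel is exactly the copy of `ℝ^V(H)` inside `ℝ^V(G)`.
On this copy the stresses of `H` act as stresses of `G`. So one stress followed by an optimal
sequence for `(H, c')` is a sequence for `(G, c)`. The maximum is attained because there are only
finitely many signed graphs with vertices and edges in given finite types. -/

open Function Matrix

namespace SignedGraph

section LinearAlgebra

variable {m n : Type*}

lemma extend_zero_dotProduct [Fintype m] [Fintype n] {R : Type*} [NonUnitalNonAssocSemiring R]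
    {r : m → n} (hr : Injective r) (f : m → R) (g : n → R) :
    extend r f 0 ⬝ᵥ g = f ⬝ᵥ g ∘ r :=
  .symm <| Fintype.sum_of_injective r hr _ _
    (fun v hv => by rw [extend_apply' _ _ _ hv, Pi.zero_apply, zero_mul])
    (fun w => by rw [hr.extend_apply, Function.comp_apply])

lemma finrank_image_of_injective {K V W : Type*} [DivisionRing K] [AddCommGroup V] [AddCommGroup W]
    [Module K V] [Module K W] {f : V →ₗ[K] W} (hf : Injective f) (S : Set V) :
    (f '' S).finrank K = S.finrank K := by
  rw [Set.finrank, ← Submodule.map_span]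
  exact (Submodule.equivMapOfInjective f hf _).finrank_eq.symm

lemma apply_eq_mul_apply_of_posSemidef [Finite n] {X : Matrix n n ℝ} (hX : X.PosSemidef) {a b : n}
    {t : ℝ} (h : X a a - 2 * t * X a b + t ^ 2 * X b b ≤ 0) (i : n) : X i a = t * X i b := by
  classical
  have := Fintype.ofFinite n
  -- The vector `e_a - t e_b` is isotropic, hence in the kernel of `X`.
  let y : n → ℝ := Pi.single a 1 - t • Pi.single b 1
  have hXy : X *ᵥ y = X.col a - t • X.col b := by
    simp only [y, mulVec_sub, mulVec_smul, mulVec_single_one]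
  have hsymm : X b a = X a b := by simpa using hX.1.apply a b
  have hyXy : star y ⬝ᵥ X *ᵥ y = 0 := by
    refine le_antisymm (le_of_eq_of_le ?_ h) (hX.dotProduct_mulVec_nonneg y)
    rw [hXy, star_trivial]
    simp only [y, sub_dotProduct, smul_dotProduct, single_one_dotProduct, Pi.sub_apply,
      Pi.smul_apply, col_apply, smul_eq_mul, hsymm]
    ring
  have hker := congrFun ((hX.dotProduct_mulVec_zero_iff y).1 hyXy) i
  rw [hXy] at hker
  exact sub_eq_zero.1 hker

/-- Composition with `φ` followed by multiplication by `s`: the linear map on vectors that is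
induced by a vertex map `φ` together with a resigning `s`. -/
def signedPullback {R : Type*} [CommSemiring R] (φ : m → n) (s : m → R) :
    (n → R) →ₗ[R] (m → R) where
  toFun x a := s a * x (φ a)
  map_add' x y := by ext a; exact mul_add _ _ _
  map_smul' t x := by ext a; exact mul_left_comm _ _ _

/-- The action on matrices that corresponds to `signedPullback` on vectors: `x xᵀ` is sent to
`y yᵀ`, where `y` is the signed pullback of `x`. -/
def signedCongr {R : Type*} [Mul R] (φ : m → n) (s : m → R) (X : Matrix n n R) : Matrix m m R :=
  of fun a b => s a * s b * X (φ a) (φ b)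

@[simp]
lemma signedPullback_apply {R : Type*} [CommSemiring R] (φ : m → n) (s : m → R) (x : n → R)
    (a : m) : signedPullback φ s x a = s a * x (φ a) := rfl

@[simp]
lemma signedCongr_apply {R : Type*} [Mul R] (φ : m → n) (s : m → R) (X : Matrix n n R) (a b : m) :
    signedCongr φ s X a b = s a * s b * X (φ a) (φ b) := rfl

lemma signedPullback_injective {R : Type*} [CommRing R] [IsDomain R] {φ : m → n} {s : m → R}
    (hφ : Surjective φ) (hs : ∀ a, s a ≠ 0) : Injective (signedPullback φ s) := by
  refine fun x y hxy => funext <| hφ.forall.2 fun a => ?_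
  exact mul_left_cancel₀ (hs a) (congrFun hxy a)

lemma signedCongr_eq_mul {R : Type*} [CommSemiring R] [Fintype m] [DecidableEq m] (φ : m → n)
    (s : m → R) (X : Matrix n n R) :
    signedCongr φ s X = diagonal s * X.submatrix φ φ * diagonal s := by
  ext a b
  simp [mul_right_comm]

lemma posSemidef_signedCongr [Finite m] (φ : m → n) (s : m → ℝ) {X : Matrix n n ℝ}
    (hX : X.PosSemidef) : (signedCongr φ s X).PosSemidef := by
  classical
  have := Fintype.ofFinite m
  simpa [signedCongr_eq_mul, diagonal_conjTranspose] using
    (hX.submatrix φ).conjTranspose_mul_mul_same (diagonal s)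

lemma rank_signedCongr_le {R : Type*} [CommSemiring R] [StrongRankCondition R] [Fintype m]
    [Fintype n] (φ : m → n) (s : m → R) (X : Matrix n n R) :
    (signedCongr φ s X).rank ≤ X.rank := by
  classical
  rw [signedCongr_eq_mul]
  calc (diagonal s * X.submatrix φ φ * diagonal s).rank
      ≤ (diagonal s * X.submatrix φ φ).rank := rank_mul_le_left _ _
    _ ≤ (X.submatrix φ φ).rank := rank_mul_le_right _ _
    _ ≤ X.rank := rank_submatrix_le X φ φ

lemma signedCongr_rightInverse {R : Type*} [CommSemiring R] {φ : m → n} {s : m → R} {r : n → m}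
    (hr : RightInverse r φ) (hs : ∀ a, s a * s a = 1) (X : Matrix n n R) :
    signedCongr r (s ∘ r) (signedCongr φ s X) = X := by
  ext w z
  simp only [signedCongr_apply, Function.comp_apply, hr w, hr z]
  rw [← mul_assoc, mul_mul_mul_comm, hs, hs, one_mul, one_mul]

lemma rank_signedCongr {R : Type*} [CommSemiring R] [StrongRankCondition R] [Fintype m] [Fintype n]
    {φ : m → n} {s : m → R} (hφ : Surjective φ) (hs : ∀ a, s a * s a = 1) (X : Matrix n n R) :
    (signedCongr φ s X).rank = X.rank := by
  obtain ⟨r, hr⟩ := hφ.hasRightInverse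
  refine (rank_signedCongr_le φ s X).antisymm ?_
  conv_lhs => rw [← signedCongr_rightInverse hr hs X]
  exact rank_signedCongr_le _ _ _

section Nested

variable [Fintype m] [Fintype n] {k : ℕ} {Y : Fin (k + 1) → Matrix n n ℝ}
  {Z : Fin k → Matrix m m ℝ} {f : (m → ℝ) → (n → ℝ)}

lemma nullSet_succ_eq_image (hzero : ∀ x, x ⬝ᵥ Y 0 *ᵥ x = 0 ↔ x ∈ Set.range f)
    (hsucc : ∀ i x, f x ⬝ᵥ Y i.succ *ᵥ f x = x ⬝ᵥ Z i *ᵥ x) (j : ℕ) :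
    nullSet Y (j + 1) = f '' nullSet Z j := by
  ext x
  have hx : x ∈ nullSet Y (j + 1) ↔ x ∈ Set.range f ∧
      ∀ i : Fin k, (i : ℕ) < j → x ⬝ᵥ Y i.succ *ᵥ x = 0 := by
    simp [nullSet, Fin.forall_fin_succ, hzero]
  rw [hx]
  constructor
  · rintro ⟨⟨y, rfl⟩, hy⟩
    exact ⟨y, fun i hi => hsucc i y ▸ hy i hi, rfl⟩
  · rintro ⟨y, hy, rfl⟩
    exact ⟨⟨y, rfl⟩, fun i hi => (hsucc i y).trans (hy i hi)⟩

lemma IsNestedPSD.of_succ (hZ : IsNestedPSD Z) (hpos : ∀ x, 0 ≤ x ⬝ᵥ Y 0 *ᵥ x)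
    (hzero : ∀ x, x ⬝ᵥ Y 0 *ᵥ x = 0 ↔ x ∈ Set.range f)
    (hsucc : ∀ i x, f x ⬝ᵥ Y i.succ *ᵥ f x = x ⬝ᵥ Z i *ᵥ x) : IsNestedPSD Y := by
  refine Fin.cases (fun x _ => hpos x) fun i x hx => ?_
  rw [Fin.val_succ, nullSet_succ_eq_image hzero hsucc] at hx
  obtain ⟨y, hy, rfl⟩ := hx
  exact (hZ i y hy).trans_eq (hsucc i y).symm

end Nested

end LinearAlgebra

variable {α β : Type*}

section Sign

attribute [instance] loopless

open scoped Classical in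
/-- The sign of an edge: `-1` if it is odd and `1` otherwise. Multiplying weights, matrix entries
and stresses by it makes every edge behave like an even one. -/
noncomputable def sign (G : SignedGraph α β) (e : β) : ℝ := if e ∈ G.odd then -1 else 1

lemma sign_mul_self (G : SignedGraph α β) (e : β) : G.sign e * G.sign e = 1 := by
  unfold sign
  split_ifs <;> norm_num

lemma sign_mul_sign_mul (G : SignedGraph α β) (e : β) (t : ℝ) : G.sign e * (G.sign e * t) = t := by
  rw [← mul_assoc, sign_mul_self, one_mul]

lemma abs_sign_mul (G : SignedGraph α β) (e : β) (t : ℝ) : |G.sign e * t| = |t| := by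
  unfold sign
  split_ifs <;> simp

lemma isFeasible_iff {G : SignedGraph α β} {c : G.Edge → ℝ} {X : Matrix G.Vert G.Vert ℝ} :
    G.IsFeasible c X ↔ X.PosSemidef ∧ (∀ v, X v v = 1) ∧
      ∀ (e : G.Edge) (a b : G.Vert), G.IsLink e a b → G.sign e * c e ≤ G.sign e * X a b := by
  refine and_congr_right' <| and_congr_right' <| forall₃_congr fun e a b =>
    imp_congr_right fun _ => ?_
  unfold sign
  split_ifs <;> simp

lemma isProperlySigned_iff {G : SignedGraph α β} {ω : G.Vert ⊕ G.Edge → ℝ} :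
    G.IsProperlySigned ω ↔ ∀ e : G.Edge, G.sign e * ω (Sum.inr e) ≤ 0 := by
  refine forall_congr' fun e => ?_
  by_cases he : (e : β) ∈ G.odd <;> simp [sign, he]

lemma isNondegenerate_iff {G : SignedGraph α β} {c : G.Edge → ℝ} :
    G.IsNondegenerate c ↔ ∀ e : G.Edge, G.sign e * c e ≠ 1 := by
  refine forall_congr' fun e => ?_
  by_cases he : (e : β) ∈ G.odd <;> simp [sign, he, neg_eq_iff_eq_neg]

/-- The vectors that agree, up to the sign of the edge, on the ends of each degenerate edge. -/
def tightSpace (G : SignedGraph α β) (c : G.Edge → ℝ) : Set (G.Vert → ℝ) :=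
  {x | ∀ (e : G.Edge) (a b : G.Vert), G.IsLink e a b → G.sign e * c e = 1 → x a = G.sign e * x b}

lemma IsFeasible.row_mem_tightSpace [Finite α] {G : SignedGraph α β} {c : G.Edge → ℝ}
    {X : Matrix G.Vert G.Vert ℝ} (hX : G.IsFeasible c X) (i : G.Vert) : X i ∈ G.tightSpace c := by
  obtain ⟨hpsd, hdiag, hedge⟩ := isFeasible_iff.1 hX
  intro e a b hab hce
  refine apply_eq_mul_apply_of_posSemidef hpsd ?_ i
  rw [hdiag, hdiag]
  linarith [hedge e a b hab, G.sign_mul_self e]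

end Sign

section Stress

/-- One of the two ends of an edge, chosen arbitrarily; the other one is `rightEnd`. -/
noncomputable def leftEnd (G : SignedGraph α β) (e : G.Edge) : G.Vert :=
  ⟨_, (G.exists_isLink_of_mem_edgeSet e.2).choose_spec.choose_spec.left_mem⟩

/-- The end of an edge other than `leftEnd`. -/
noncomputable def rightEnd (G : SignedGraph α β) (e : G.Edge) : G.Vert :=
  ⟨_, (G.exists_isLink_of_mem_edgeSet e.2).choose_spec.choose_spec.right_mem⟩

lemma isLink_leftEnd_rightEnd (G : SignedGraph α β) (e : G.Edge) :
    G.IsLink e (G.leftEnd e) (G.rightEnd e) :=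
  (G.exists_isLink_of_mem_edgeSet e.2).choose_spec.choose_spec

/-- The entries of `x xᵀ` on the vertices and edges of `G`. Stresses act on them by the dot
product. -/
noncomputable def squareEntries (G : SignedGraph α β) (x : G.Vert → ℝ) : G.Vert ⊕ G.Edge → ℝ :=
  Sum.elim (fun v => x v * x v) fun e => x (G.leftEnd e) * x (G.rightEnd e)

lemma squareEntries_inr {G : SignedGraph α β} {e : G.Edge} {a b : G.Vert} (hab : G.IsLink e a b)
    (x : G.Vert → ℝ) : G.squareEntries x (Sum.inr e) = x a * x b := by
  rcases hab.eq_and_eq_or_eq_and_eq (G.isLink_leftEnd_rightEnd e) with ⟨ha, hb⟩ | ⟨ha, hb⟩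
  · rw [Subtype.ext ha, Subtype.ext hb]
    rfl
  · rw [Subtype.ext ha, Subtype.ext hb, mul_comm]
    rfl

lemma mem_tightSpace_iff {G : SignedGraph α β} {c : G.Edge → ℝ} {x : G.Vert → ℝ} :
    x ∈ G.tightSpace c ↔ ∀ e : G.Edge, G.sign e * c e = 1 →
      x (G.leftEnd e) = G.sign e * x (G.rightEnd e) := by
  refine ⟨fun hx e => hx e _ _ (G.isLink_leftEnd_rightEnd e), fun hx e a b hab hce => ?_⟩
  rcases hab.eq_and_eq_or_eq_and_eq (G.isLink_leftEnd_rightEnd e) with ⟨ha, hb⟩ | ⟨ha, hb⟩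
  · rw [Subtype.ext ha, Subtype.ext hb, hx e hce]
  · rw [Subtype.ext ha, Subtype.ext hb, hx e hce, sign_mul_sign_mul]

open scoped Classical in
lemma edgeMatrix_eq {G : SignedGraph α β} {e : G.Edge} {a b : G.Vert} (hab : G.IsLink e a b) :
    G.edgeMatrix e = (1 / 2 : ℝ) • (single a b 1 + single b a 1) := by
  ext i j
  have hne : a ≠ b := fun h => hab.ne (congrArg Subtype.val h)
  simp only [edgeMatrix, of_apply, hab.isLink_iff, ← Subtype.ext_iff, Matrix.smul_apply,
    Matrix.add_apply, single_apply, smul_eq_mul]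
  split_ifs <;> grind

open scoped Classical in
lemma dotProduct_edgeMatrix_mulVec [Fintype α] {G : SignedGraph α β} (e : G.Edge) (x : G.Vert → ℝ) :
    x ⬝ᵥ G.edgeMatrix e *ᵥ x = G.squareEntries x (Sum.inr e) := by
  have hab := G.isLink_leftEnd_rightEnd e
  rw [edgeMatrix_eq hab, squareEntries_inr hab]
  simp [add_mulVec, single_mulVec, update_apply, dotProduct, Finset.sum_add_distrib, mul_add]
  ring

open scoped Classical in
/-- The stress with quadratic form `(x a - sign e * x b) ^ 2`, where `a` and `b` are the ends of
`e`. -/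
noncomputable def edgeStress (G : SignedGraph α β) (e : G.Edge) : G.Vert ⊕ G.Edge → ℝ :=
  Sum.elim (Pi.single (G.leftEnd e) 1 + Pi.single (G.rightEnd e) 1) (Pi.single e (-2 * G.sign e))

variable [Fintype β]

open scoped Classical in
/-- The degenerate edges: those at which a weight vector attains the value that
`IsNondegenerate` excludes. -/
noncomputable def tightEdges (G : SignedGraph α β) (c : G.Edge → ℝ) : Finset G.Edge :=
  {e : G.Edge | G.sign e * c e = 1}

lemma mem_tightEdges {G : SignedGraph α β} {c : G.Edge → ℝ} {e : G.Edge} :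
    e ∈ G.tightEdges c ↔ G.sign e * c e = 1 := by
  simp [tightEdges]

open scoped Classical in
/-- The sum of the stresses of the degenerate edges; its matrix is positive semidefinite with
kernel `tightSpace`. -/
noncomputable def tightStress (G : SignedGraph α β) (c : G.Edge → ℝ) : G.Vert ⊕ G.Edge → ℝ :=
  ∑ e ∈ G.tightEdges c, G.edgeStress e

lemma isProperlySigned_tightStress (G : SignedGraph α β) (c : G.Edge → ℝ) :
    G.IsProperlySigned (G.tightStress c) := by
  classical
  refine isProperlySigned_iff.2 fun e => ?_
  rw [tightStress, Finset.sum_apply, Finset.mul_sum]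
  refine Finset.sum_nonpos fun f _ => ?_
  obtain rfl | hef := eq_or_ne e f
  · simp [edgeStress, mul_left_comm, G.sign_mul_self]
  · simp [edgeStress, hef]

variable [Fintype α]

open scoped Classical in
lemma dotProduct_stressMatrix_mulVec (G : SignedGraph α β) (ω : G.Vert ⊕ G.Edge → ℝ)
    (x : G.Vert → ℝ) : x ⬝ᵥ G.stressMatrix ω *ᵥ x = ω ⬝ᵥ G.squareEntries x := by
  simp only [stressMatrix, add_mulVec, dotProduct_add, sum_mulVec, dotProduct_sum, smul_mulVec,
    dotProduct_smul, dotProduct_edgeMatrix_mulVec, smul_eq_mul]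
  simp only [dotProduct, mulVec_diagonal, Fintype.sum_sum_type, squareEntries, Sum.elim_inl,
    mul_left_comm]

open scoped Classical in
lemma dualValue_eq_dotProduct (G : SignedGraph α β) (c : G.Edge → ℝ) (ω : G.Vert ⊕ G.Edge → ℝ) :
    G.dualValue c ω = ω ⬝ᵥ Sum.elim 1 c := by
  simp [dualValue, dotProduct]

open scoped Classical in
lemma edgeStress_dotProduct (G : SignedGraph α β) (e : G.Edge) (f : G.Vert → ℝ) (g : G.Edge → ℝ) :
    G.edgeStress e ⬝ᵥ Sum.elim f g = f (G.leftEnd e) + f (G.rightEnd e) - 2 * (G.sign e * g e) := by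
  rw [edgeStress, sumElim_dotProduct_sumElim, add_dotProduct, single_dotProduct, single_dotProduct,
    single_dotProduct]
  ring

lemma dualValue_tightStress (G : SignedGraph α β) (c : G.Edge → ℝ) :
    G.dualValue c (G.tightStress c) = 0 := by
  classical
  rw [dualValue_eq_dotProduct, tightStress, sum_dotProduct]
  refine Finset.sum_eq_zero fun e he => ?_
  rw [edgeStress_dotProduct, mem_tightEdges.1 he]
  norm_num

open scoped Classical in
lemma dotProduct_stressMatrix_tightStress_mulVec (G : SignedGraph α β) (c : G.Edge → ℝ)
    (x : G.Vert → ℝ) : x ⬝ᵥ G.stressMatrix (G.tightStress c) *ᵥ x =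
      ∑ e ∈ G.tightEdges c, (x (G.leftEnd e) - G.sign e * x (G.rightEnd e)) ^ 2 := by
  rw [dotProduct_stressMatrix_mulVec, tightStress, sum_dotProduct]
  refine Finset.sum_congr rfl fun e _ => ?_
  rw [squareEntries, edgeStress_dotProduct]
  linear_combination -(x (G.rightEnd e) ^ 2) * G.sign_mul_self e

open scoped Classical in
lemma dotProduct_stressMatrix_tightStress_mulVec_nonneg (G : SignedGraph α β) (c : G.Edge → ℝ)
    (x : G.Vert → ℝ) : 0 ≤ x ⬝ᵥ G.stressMatrix (G.tightStress c) *ᵥ x := by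
  rw [dotProduct_stressMatrix_tightStress_mulVec]
  exact Finset.sum_nonneg fun e _ => sq_nonneg _

open scoped Classical in
lemma dotProduct_stressMatrix_tightStress_mulVec_eq_zero_iff {G : SignedGraph α β}
    {c : G.Edge → ℝ} {x : G.Vert → ℝ} :
    x ⬝ᵥ G.stressMatrix (G.tightStress c) *ᵥ x = 0 ↔ x ∈ G.tightSpace c := by
  rw [dotProduct_stressMatrix_tightStress_mulVec, mem_tightSpace_iff,
    Finset.sum_eq_zero_iff_of_nonneg fun _ _ => sq_nonneg _]
  simp only [mem_tightEdges, sq_eq_zero_iff, sub_eq_zero]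

end Stress

section Lift

variable {G H : SignedGraph α β}

/-- The stress on `G` that a stress `ω` on `H` induces along the maps `r` and `ι` on vertices and
edges: it is zero off their ranges, and each edge stress is adjusted to the sign of the edge
in `G`. -/
noncomputable def liftStress (r : H.Vert → G.Vert) (ι : H.Edge → G.Edge) (ω : H.Vert ⊕ H.Edge → ℝ) :
    G.Vert ⊕ G.Edge → ℝ :=
  Sum.elim (extend r (ω ∘ Sum.inl) 0)
    (extend ι (fun e => H.sign e * (G.sign (ι e) * ω (Sum.inr e))) 0)

variable {r : H.Vert → G.Vert} {ι : H.Edge → G.Edge} {ω : H.Vert ⊕ H.Edge → ℝ}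

lemma isProperlySigned_liftStress (hι : Injective ι) (hω : H.IsProperlySigned ω) :
    G.IsProperlySigned (liftStress r ι ω) := by
  rw [isProperlySigned_iff] at hω ⊢
  refine fun e => ?_
  by_cases he : ∃ f, ι f = e
  · obtain ⟨f, rfl⟩ := he
    rw [liftStress, Sum.elim_inr, hι.extend_apply, mul_left_comm, sign_mul_sign_mul]
    exact hω f
  · rw [liftStress, Sum.elim_inr, extend_apply' _ _ _ he, Pi.zero_apply, mul_zero]

open scoped Classical in
lemma liftStress_dotProduct [Fintype α] [Fintype β] (hr : Injective r) (hι : Injective ι)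
    (f : G.Vert → ℝ) (g : G.Edge → ℝ) :
    liftStress r ι ω ⬝ᵥ Sum.elim f g =
      ω ⬝ᵥ Sum.elim (f ∘ r) fun e => H.sign e * (G.sign (ι e) * g (ι e)) := by
  nth_rw 2 [← Sum.elim_comp_inl_inr ω]
  rw [liftStress, sumElim_dotProduct_sumElim, sumElim_dotProduct_sumElim,
    extend_zero_dotProduct hr, extend_zero_dotProduct hι]
  congr 1
  refine Finset.sum_congr rfl fun e _ => ?_
  simp only [Function.comp_apply]
  ring

end Lift

section SignedQuotient

variable {G H K : SignedGraph α β} {c : G.Edge → ℝ} {c' : H.Edge → ℝ} {c'' : K.Edge → ℝ}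
  {φ : G.Vert → H.Vert} {φ' : H.Vert → K.Vert} {s : G.Vert → ℝ} {s' : H.Vert → ℝ}

/-- `(H, c')` arises from `(G, c)` by resigning with the signs `s` and then identifying the vertices
in each fiber of `φ`. By `collapse`, each deleted edge has its ends in one fiber. By `tight_fiber`,
the degenerate edges of `(G, c)` force the identifications. -/
structure IsSignedQuotient (G H : SignedGraph α β) (c : G.Edge → ℝ) (c' : H.Edge → ℝ)
    (φ : G.Vert → H.Vert) (s : G.Vert → ℝ) : Prop where
  surjective : Surjective φ
  mul_self : ∀ a, s a * s a = 1
  edgeSet_subset : H.edgeSet ⊆ G.edgeSet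
  isLink : ∀ {e} {a b : G.Vert}, e ∈ H.edgeSet → G.IsLink e a b → H.IsLink e (φ a) (φ b)
  sign_eq : ∀ {e} {a b : G.Vert}, e ∈ H.edgeSet → G.IsLink e a b →
    H.sign e = s a * s b * G.sign e
  weight_eq : ∀ e : H.Edge, H.sign e * c' e = G.sign e * c ⟨e, edgeSet_subset e.2⟩
  collapse : ∀ {e} {a b : G.Vert}, e ∉ H.edgeSet → G.IsLink e a b → φ a = φ b
  tight_fiber : ∀ {x a b}, x ∈ G.tightSpace c → φ a = φ b → s a * x a = s b * x b

namespace IsSignedQuotient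

lemma refl (G : SignedGraph α β) (c : G.Edge → ℝ) : IsSignedQuotient G G c c id 1 where
  surjective := surjective_id
  mul_self _ := one_mul 1
  edgeSet_subset := subset_rfl
  isLink _ hab := hab
  sign_eq _ _ := by simp
  weight_eq _ := rfl
  collapse he hab := absurd hab.edge_mem he
  tight_fiber {x _ _} _ hab := congrArg (1 * x) hab

lemma exists_isLink (hq : IsSignedQuotient G H c c' φ s) {e : β} {v w : H.Vert}
    (hvw : H.IsLink e v w) : ∃ a b : G.Vert, G.IsLink e a b ∧ φ a = v ∧ φ b = w := by
  obtain ⟨a, b, hab⟩ := G.exists_isLink_of_mem_edgeSet (hq.edgeSet_subset hvw.edge_mem)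
  lift a to G.Vert using hab.left_mem
  lift b to G.Vert using hab.right_mem
  rcases (hq.isLink hvw.edge_mem hab).eq_and_eq_or_eq_and_eq hvw with ⟨ha, hb⟩ | ⟨ha, hb⟩
  · exact ⟨a, b, hab, Subtype.ext ha, Subtype.ext hb⟩
  · exact ⟨b, a, hab.symm, Subtype.ext hb, Subtype.ext ha⟩

lemma mul_mul_cancel (hq : IsSignedQuotient G H c c' φ s) (a : G.Vert) (t : ℝ) :
    s a * (s a * t) = t := by
  rw [← mul_assoc, hq.mul_self, one_mul]

lemma exists_signedPullback_eq (hq : IsSignedQuotient G H c c' φ s) {x : G.Vert → ℝ}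
    (hx : x ∈ G.tightSpace c) : ∃ y ∈ H.tightSpace c', signedPullback φ s y = x := by
  obtain ⟨r, hr⟩ := hq.surjective.hasRightInverse
  have hy (a : G.Vert) : signedPullback r (s ∘ r) x (φ a) = s a * x a :=
    hq.tight_fiber hx (hr (φ a))
  refine ⟨signedPullback r (s ∘ r) x, fun e v w hvw hce => ?_, funext fun a => ?_⟩
  · obtain ⟨a, b, hab, rfl, rfl⟩ := hq.exists_isLink hvw
    rw [hy, hy, hx ⟨e, hq.edgeSet_subset e.2⟩ a b hab ((hq.weight_eq e).symm.trans hce),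
      hq.sign_eq e.2 hab]
    linear_combination -(s a * G.sign e * x b) * hq.mul_self b
  · rw [signedPullback_apply, hy, hq.mul_mul_cancel]

lemma trans (hq : IsSignedQuotient G H c c' φ s) (hq' : IsSignedQuotient H K c' c'' φ' s') :
    IsSignedQuotient G K c c'' (φ' ∘ φ) fun a => s a * s' (φ a) where
  surjective := hq'.surjective.comp hq.surjective
  mul_self a := by rw [mul_mul_mul_comm, hq.mul_self, hq'.mul_self, one_mul]
  edgeSet_subset := hq'.edgeSet_subset.trans hq.edgeSet_subset
  isLink he hab := hq'.isLink he (hq.isLink (hq'.edgeSet_subset he) hab)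
  sign_eq {e a b} he hab := by
    have he' := hq'.edgeSet_subset he
    rw [hq'.sign_eq he (hq.isLink he' hab), hq.sign_eq he' hab]
    ring
  weight_eq e := (hq'.weight_eq e).trans (hq.weight_eq ⟨e, hq'.edgeSet_subset e.2⟩)
  collapse {e a b} he hab := by
    by_cases he' : e ∈ H.edgeSet
    · exact hq'.collapse he (hq.isLink he' hab)
    · exact congrArg φ' (hq.collapse he' hab)
  tight_fiber {x a b} hx hab := by
    obtain ⟨y, hy, rfl⟩ := hq.exists_signedPullback_eq hx
    have hs (v : G.Vert) : s v * s' (φ v) * signedPullback φ s y v = s' (φ v) * y (φ v) := by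
      rw [signedPullback_apply, mul_comm (s v), mul_assoc, hq.mul_mul_cancel]
    rw [hs, hs]
    exact hq'.tight_fiber hy hab

section Feasible

variable [Finite α]

lemma apply_eq_of_map_eq (hq : IsSignedQuotient G H c c' φ s) {X : Matrix G.Vert G.Vert ℝ}
    (hX : G.IsFeasible c X) {a b : G.Vert} (hab : φ a = φ b) : X a b = s a * s b := by
  have hrow := hq.tight_fiber (hX.row_mem_tightSpace a) hab
  rw [hX.2.1, mul_one] at hrow
  rw [hrow, mul_right_comm, hq.mul_self, one_mul]

lemma isFeasible_signedCongr (hq : IsSignedQuotient G H c c' φ s) {X : Matrix G.Vert G.Vert ℝ}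
    (hX : G.IsFeasible c X) {X' : Matrix H.Vert H.Vert ℝ} (hX' : H.IsFeasible c' X') :
    G.IsFeasible c (signedCongr φ s X') := by
  obtain ⟨hpsd', hdiag', hedge'⟩ := isFeasible_iff.1 hX'
  refine isFeasible_iff.2 ⟨posSemidef_signedCongr _ _ hpsd', fun v => ?_, fun e a b hab => ?_⟩
  · rw [signedCongr_apply, hdiag', hq.mul_self, one_mul]
  rw [signedCongr_apply]
  by_cases he : (e : β) ∈ H.edgeSet
  · calc G.sign e * c e = H.sign e * c' ⟨e, he⟩ := (hq.weight_eq ⟨e, he⟩).symm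
      _ ≤ H.sign e * X' (φ a) (φ b) := hedge' ⟨e, he⟩ _ _ (hq.isLink he hab)
      _ = G.sign e * (s a * s b * X' (φ a) (φ b)) := by rw [hq.sign_eq he hab]; ring
  · have hφ := hq.collapse he hab
    rw [← hφ, hdiag', mul_one, ← hq.apply_eq_of_map_eq hX hφ]
    exact (isFeasible_iff.1 hX).2.2 e a b hab

lemma exists_signedCongr_eq (hq : IsSignedQuotient G H c c' φ s) {X : Matrix G.Vert G.Vert ℝ}
    (hX : G.IsFeasible c X) : ∃ X', H.IsFeasible c' X' ∧ signedCongr φ s X' = X := by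
  obtain ⟨r, hr⟩ := hq.surjective.hasRightInverse
  obtain ⟨hpsd, hdiag, hedge⟩ := isFeasible_iff.1 hX
  have hsymm (i j : G.Vert) : X i j = X j i := by simpa using hpsd.1.apply j i
  have hfiber (i a : G.Vert) : s (r (φ a)) * X i (r (φ a)) = s a * X i a :=
    hq.tight_fiber (hX.row_mem_tightSpace i) (hr (φ a))
  have hX' (a b : G.Vert) : signedCongr r (s ∘ r) X (φ a) (φ b) = s a * s b * X a b :=
    calc s (r (φ a)) * s (r (φ b)) * X (r (φ a)) (r (φ b))
        = s (r (φ a)) * (s b * X (r (φ a)) b) := by rw [mul_assoc, hfiber]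
      _ = s b * (s a * X b a) := by rw [mul_left_comm, hsymm, hfiber]
      _ = s a * s b * X a b := by rw [hsymm, mul_left_comm, mul_assoc]
  refine ⟨signedCongr r (s ∘ r) X, isFeasible_iff.2
    ⟨posSemidef_signedCongr _ _ hpsd, fun v => ?_, fun e v w hvw => ?_⟩, ?_⟩
  · rw [signedCongr_apply, hdiag, mul_one, Function.comp_apply, hq.mul_self]
  · obtain ⟨a, b, hab, rfl, rfl⟩ := hq.exists_isLink hvw
    calc H.sign e * c' e = G.sign e * c ⟨e, hq.edgeSet_subset e.2⟩ := hq.weight_eq e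
      _ ≤ G.sign e * X a b := hedge ⟨e, hq.edgeSet_subset e.2⟩ a b hab
      _ = H.sign e * signedCongr r (s ∘ r) X (φ a) (φ b) := by
        rw [hX', hq.sign_eq e.2 hab]
        linear_combination (-(G.sign e * X a b)) * (s b * s b * hq.mul_self a + hq.mul_self b)
  · ext a b
    rw [signedCongr_apply, hX', mul_assoc, mul_assoc, mul_left_comm (s b), hq.mul_mul_cancel,
      hq.mul_mul_cancel]

lemma mem_feasibleWeights (hq : IsSignedQuotient G H c c' φ s) (hc : c ∈ G.feasibleWeights) :
    c' ∈ H.feasibleWeights := by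
  obtain ⟨hbound, X, hX⟩ := hc
  refine ⟨fun e => ?_, (hq.exists_signedCongr_eq hX).imp fun _ => And.left⟩
  rw [Set.mem_Icc, ← abs_le, ← H.abs_sign_mul e, hq.weight_eq, G.abs_sign_mul, abs_le]
  exact hbound _

lemma tightSpace_eq_range (hq : IsSignedQuotient G H c c' φ s) (hc : c ∈ G.feasibleWeights)
    (hc' : H.IsNondegenerate c') : G.tightSpace c = Set.range (signedPullback φ s) := by
  obtain ⟨-, X, hX⟩ := hc
  refine Set.Subset.antisymm (fun x hx => ?_) ?_
  · exact (hq.exists_signedPullback_eq hx).imp fun _ => And.right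
  rintro _ ⟨y, rfl⟩ e a b hab hce
  have he (h : (e : β) ∈ H.edgeSet) : False :=
    isNondegenerate_iff.1 hc' ⟨e, h⟩ ((hq.weight_eq ⟨e, h⟩).trans hce)
  have hφ := hq.collapse he hab
  have hs : s b * s a = G.sign e := by
    have hrow := hX.row_mem_tightSpace b e a b hab hce
    rwa [hq.apply_eq_of_map_eq hX hφ.symm, hX.2.1, mul_one] at hrow
  rw [signedPullback_apply, signedPullback_apply, hφ, ← hs]
  linear_combination (-(s a * y (φ b))) * hq.mul_self b

end Feasible

section Reduction

variable [Fintype α] [Fintype β]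

lemma dualValue_liftStress (hq : IsSignedQuotient G H c c' φ s) {r : H.Vert → G.Vert}
    (hr : Injective r) (ω : H.Vert ⊕ H.Edge → ℝ) :
    G.dualValue c (liftStress r (Set.inclusion hq.edgeSet_subset) ω) = H.dualValue c' ω := by
  classical
  rw [dualValue_eq_dotProduct, dualValue_eq_dotProduct,
    liftStress_dotProduct hr (Set.inclusion_injective _)]
  congr! 2
  funext e
  rw [← H.sign_mul_sign_mul e (c' e), hq.weight_eq]

open scoped Classical in
lemma dotProduct_stressMatrix_liftStress_mulVec (hq : IsSignedQuotient G H c c' φ s)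
    {r : H.Vert → G.Vert} (hr : RightInverse r φ) (ω : H.Vert ⊕ H.Edge → ℝ) (y : H.Vert → ℝ) :
    signedPullback φ s y ⬝ᵥ
        G.stressMatrix (liftStress r (Set.inclusion hq.edgeSet_subset) ω) *ᵥ signedPullback φ s y =
      y ⬝ᵥ H.stressMatrix ω *ᵥ y := by
  rw [dotProduct_stressMatrix_mulVec, dotProduct_stressMatrix_mulVec, squareEntries,
    liftStress_dotProduct hr.injective (Set.inclusion_injective _)]
  congr 1
  ext (w | e)
  · change s (r w) * y (φ (r w)) * (s (r w) * y (φ (r w))) = y w * y w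
    rw [hr w, mul_mul_mul_comm, hq.mul_self, one_mul]
  · let f := Set.inclusion hq.edgeSet_subset e
    have hab := G.isLink_leftEnd_rightEnd f
    rw [squareEntries_inr (hq.isLink e.2 hab)]
    change H.sign e * (G.sign e * (s (G.leftEnd f) * y _ * (s (G.rightEnd f) * y _))) = _
    linear_combination (-(y (φ (G.leftEnd f)) * y (φ (G.rightEnd f)) * H.sign e)) *
      hq.sign_eq e.2 hab + y (φ (G.leftEnd f)) * y (φ (G.rightEnd f)) * H.sign_mul_self e

lemma hasFacialReduction_succ (hq : IsSignedQuotient G H c c' φ s) (hc : c ∈ G.feasibleWeights)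
    (hc' : H.IsNondegenerate c') {k : ℕ} (h : H.HasFacialReduction c' k) :
    G.HasFacialReduction c (k + 1) := by
  classical
  obtain ⟨ω, hsigned, hnested, hvalue, X', hX', hmax, hrank⟩ := h
  obtain ⟨r, hr⟩ := hq.surjective.hasRightInverse
  let ι := Set.inclusion hq.edgeSet_subset
  let Ω : Fin (k + 1) → G.Vert ⊕ G.Edge → ℝ := Fin.cons (G.tightStress c) (liftStress r ι ∘ ω)
  have hzero (x : G.Vert → ℝ) :
      x ⬝ᵥ G.stressMatrix (Ω 0) *ᵥ x = 0 ↔ x ∈ Set.range (signedPullback φ s) :=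
    hq.tightSpace_eq_range hc hc' ▸ dotProduct_stressMatrix_tightStress_mulVec_eq_zero_iff
  have hsucc (i : Fin k) (y : H.Vert → ℝ) :
      signedPullback φ s y ⬝ᵥ G.stressMatrix (Ω i.succ) *ᵥ signedPullback φ s y =
        y ⬝ᵥ H.stressMatrix (ω i) *ᵥ y :=
    hq.dotProduct_stressMatrix_liftStress_mulVec hr (ω i) y
  refine ⟨Ω, ?_, ?_, ?_, signedCongr φ s X', ?_, ?_, ?_⟩
  · exact Fin.cases (G.isProperlySigned_tightStress c) fun i =>
      isProperlySigned_liftStress (Set.inclusion_injective _) (hsigned i)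
  · exact hnested.of_succ (G.dotProduct_stressMatrix_tightStress_mulVec_nonneg c) hzero hsucc
  · exact Fin.cases (G.dualValue_tightStress c).le fun i =>
      (hq.dualValue_liftStress hr.injective (ω i)).trans_le (hvalue i)
  · exact hq.isFeasible_signedCongr hc.2.choose_spec hX'
  · intro X hX
    obtain ⟨Y, hY, rfl⟩ := hq.exists_signedCongr_eq hX
    rw [rank_signedCongr hq.surjective hq.mul_self, rank_signedCongr hq.surjective hq.mul_self]
    exact hmax Y hY
  · have hinj := signedPullback_injective hq.surjective fun a =>
      left_ne_zero_of_mul_eq_one (hq.mul_self a)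
    have hnull : nullSet (fun j => G.stressMatrix (Ω j)) (k + 1) =
        signedPullback φ s '' nullSet (fun j => H.stressMatrix (ω j)) k :=
      nullSet_succ_eq_image (Y := fun j => G.stressMatrix (Ω j)) hzero hsucc k
    rw [hnull, finrank_image_of_injective hinj, hrank, rank_signedCongr hq.surjective hq.mul_self]

lemma sdAt_le (hq : IsSignedQuotient G H c c' φ s) (hc : c ∈ G.feasibleWeights)
    (hc' : H.IsNondegenerate c') : G.sdAt c ≤ H.sdAt c' + 1 := by
  rw [sdAt, sdAt, ENat.iInf₂_add]
  exact le_iInf₂ fun k hk => iInf₂_le (k + 1) (hq.hasFacialReduction_succ hc hc' hk)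

end Reduction

end IsSignedQuotient

end SignedQuotient

section Resign

lemma mem_cut_iff {G : SignedGraph α β} {S : Set α} {e : β} {a b : α} (hab : G.IsLink e a b) :
    e ∈ G.cut S ↔ ¬(a ∈ S ↔ b ∈ S) := by
  constructor
  · rintro ⟨x, y, hxy, hx, hy⟩
    rcases hab.eq_and_eq_or_eq_and_eq hxy with ⟨rfl, rfl⟩ | ⟨rfl, rfl⟩ <;> tauto
  · intro h
    by_cases ha : a ∈ S
    · exact ⟨a, b, hab, ha, by tauto⟩
    · exact ⟨b, a, hab.symm, by tauto, ha⟩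

open scoped Classical in
/-- The diagonal signs of the resigning on `S`: `-1` on `S` and `1` elsewhere. -/
noncomputable def cutSign (S : Set α) (a : α) : ℝ := if a ∈ S then -1 else 1

lemma sign_resign {G : SignedGraph α β} {S : Set α} {e : β} {a b : α} (hab : G.IsLink e a b) :
    (G.resign S).sign e = cutSign S a * cutSign S b * G.sign e := by
  have hodd : e ∈ (G.resign S).odd ↔ ¬(e ∈ G.odd ↔ ¬(a ∈ S ↔ b ∈ S)) := by
    rw [← mem_cut_iff hab, resign, Set.mem_symmDiff]
    tauto
  by_cases he : e ∈ G.odd <;> by_cases ha : a ∈ S <;> by_cases hb : b ∈ S <;>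
    simp [sign, cutSign, hodd, he, ha, hb]

lemma isSignedQuotient_resign (G : SignedGraph α β) (c : G.Edge → ℝ) (S : Set α) :
    IsSignedQuotient G (G.resign S) c (fun e => (G.resign S).sign e * (G.sign e * c e)) id
      fun a => cutSign S a where
  surjective := surjective_id
  mul_self a := by by_cases ha : (a : α) ∈ S <;> simp [cutSign, ha]
  edgeSet_subset := subset_rfl
  isLink _ hab := hab
  sign_eq _ hab := sign_resign hab
  weight_eq _ := sign_mul_sign_mul _ _ _
  collapse he hab := absurd hab.edge_mem he
  tight_fiber {x _ _} _ hab := congrArg (fun a : G.Vert => cutSign S a * x a) hab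

lemma exists_notMem_odd_resign {G : SignedGraph α β} {e : β} (he : e ∈ G.edgeSet) :
    ∃ S, e ∉ (G.resign S).odd := by
  by_cases heo : e ∈ G.odd
  · obtain ⟨u, v, huv⟩ := G.exists_isLink_of_mem_edgeSet he
    have hcut : e ∈ G.cut {u} := ⟨u, v, huv, rfl, huv.ne.symm⟩
    exact ⟨{u}, fun h => h.elim (fun h => h.2 hcut) fun h => h.2 heo⟩
  · exact ⟨∅, fun h => h.elim (fun h => heo h.1) fun ⟨⟨_, _, _, h, _⟩, _⟩ => h⟩

end Resign

section Contract

open scoped Classical in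
/-- The map on vertices that underlies `contract`. -/
noncomputable def identify (u v x : α) : α := if x = v then u else x

lemma identify_eq_identify_iff {u v a b : α} :
    identify u v a = identify u v b ↔
      a = b ∨ (a = u ∧ b = v) ∨ (a = v ∧ b = u) := by
  unfold identify
  grind

lemma isLink_contract_iff {G : SignedGraph α β} {u v : α} {e : β} {x y : α} :
    (G.contract u v).IsLink e x y ↔ ∃ a b, (G.IsLink e a b ∧ ¬ G.IsLink e u v) ∧
      identify u v a = x ∧ identify u v b = y := by
  simp [contract, Relation.Map, identify]

lemma mem_edgeSet_contract_iff {G : SignedGraph α β} {u v : α} {e : β} :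
    e ∈ (G.contract u v).edgeSet ↔ e ∈ G.edgeSet ∧ ¬ G.IsLink e u v := by
  simp [contract]

lemma sign_contract {G : SignedGraph α β} {u v : α} {e : β} (he : ¬ G.IsLink e u v) :
    (G.contract u v).sign e = G.sign e := by
  classical
  simp [sign, contract, he]

/-- The projection of the vertices of a graph to those of a contraction. -/
noncomputable def contractVert (G : SignedGraph α β) (u v : α) (a : G.Vert) :
    (G.contract u v).Vert :=
  ⟨identify u v a, a, a.2, rfl⟩

lemma isSignedQuotient_contract {G : SignedGraph α β} {c : G.Edge → ℝ} {u v : α} {e : G.Edge}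
    (huv : G.IsLink e u v) (heven : (e : β) ∉ G.odd) (hc : c e = 1) :
    IsSignedQuotient G (G.contract u v) c (fun f => c ⟨f, (mem_edgeSet_contract_iff.1 f.2).1⟩)
      (G.contractVert u v) 1 where
  surjective := by
    rintro ⟨_, a, ha, rfl⟩
    exact ⟨⟨a, ha⟩, rfl⟩
  mul_self _ := one_mul 1
  edgeSet_subset _ hf := (mem_edgeSet_contract_iff.1 hf).1
  isLink hf hab := isLink_contract_iff.2 ⟨_, _, ⟨hab, (mem_edgeSet_contract_iff.1 hf).2⟩, rfl, rfl⟩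
  sign_eq hf _ := by simp [sign_contract (mem_edgeSet_contract_iff.1 hf).2]
  weight_eq f := by rw [sign_contract (mem_edgeSet_contract_iff.1 f.2).2]
  collapse {f a b} hf hab := by
    have hfuv : G.IsLink f u v := by
      by_contra h
      exact hf (mem_edgeSet_contract_iff.2 ⟨hab.edge_mem, h⟩)
    exact Subtype.ext (identify_eq_identify_iff.2 (.inr (hab.eq_and_eq_or_eq_and_eq hfuv)))
  tight_fiber {x a b} hx hab := by
    have hxuv : x ⟨u, huv.left_mem⟩ = x ⟨v, huv.right_mem⟩ := by
      simpa [sign, heven] using hx e ⟨u, huv.left_mem⟩ ⟨v, huv.right_mem⟩ huv (by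
        simp [sign, heven, hc])
    rw [Pi.one_apply, Pi.one_apply, one_mul, one_mul]
    obtain ⟨a, ha⟩ := a
    obtain ⟨b, hb⟩ := b
    rcases identify_eq_identify_iff.1 (congrArg Subtype.val hab) with
      rfl | ⟨rfl, rfl⟩ | ⟨rfl, rfl⟩
    exacts [rfl, hxuv, hxuv.symm]

lemma ncard_vertexSet_contract_lt [Finite α] {G : SignedGraph α β} {e : β} {u v : α}
    (huv : G.IsLink e u v) : (G.contract u v).vertexSet.ncard < G.vertexSet.ncard := by
  have hsub : (G.contract u v).vertexSet ⊆ G.vertexSet \ {v} := by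
    rintro _ ⟨a, ha, rfl⟩
    dsimp only
    split_ifs with h
    exacts [⟨huv.left_mem, huv.ne⟩, ⟨ha, h⟩]
  exact (Set.ncard_le_ncard hsub).trans_lt (Set.ncard_sdiff_singleton_lt_of_mem huv.right_mem)

end Contract

section Splitting

instance [Finite α] [Finite β] : Finite (SignedGraph α β) := by
  let data (G : SignedGraph α β) : Set α × (β → α → α → Prop) × Set β :=
    (G.vertexSet, G.IsLink, G.odd)
  refine Finite.of_injective data fun G H hGH => ?_
  obtain ⟨hV, hlink, hodd⟩ : G.vertexSet = H.vertexSet ∧ G.IsLink = H.IsLink ∧ G.odd = H.odd := by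
    simpa [data] using hGH
  obtain ⟨G, hG, o, ho⟩ := G
  obtain ⟨H, hH, o', ho'⟩ := H
  obtain rfl : G = H := Graph.ext hV fun e x y => by rw [hlink]
  obtain rfl : o = o' := hodd
  rfl

lemma exists_isSplitting_ncard_lt [Finite α] {G : SignedGraph α β} {c : G.Edge → ℝ}
    (hc : ¬ G.IsNondegenerate c) :
    ∃ (H : SignedGraph α β) (c' : H.Edge → ℝ) (φ : G.Vert → H.Vert) (s : G.Vert → ℝ),
      G.IsSplitting H ∧ IsSignedQuotient G H c c' φ s ∧
        H.vertexSet.ncard < G.vertexSet.ncard := by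
  obtain ⟨e, hce⟩ := not_forall_not.1 (isNondegenerate_iff.not.1 hc)
  obtain ⟨S, heven⟩ := exists_notMem_odd_resign e.2
  obtain ⟨u, v, huv⟩ := G.exists_isLink_of_mem_edgeSet e.2
  have hweight : (G.resign S).sign e * (G.sign e * c e) = 1 := by
    rw [hce, mul_one, sign, if_neg heven]
  exact ⟨_, _, _, _, .tail (.single (.resign S)) (.contract (G := G.resign S) e u v huv heven),
    (G.isSignedQuotient_resign c S).trans (isSignedQuotient_contract (e := e) huv heven hweight),
    ncard_vertexSet_contract_lt (G := G.resign S) huv⟩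

lemma exists_isSplitting_isNondegenerate [Finite α] (G : SignedGraph α β) (c : G.Edge → ℝ) :
    ∃ (H : SignedGraph α β) (c' : H.Edge → ℝ) (φ : G.Vert → H.Vert) (s : G.Vert → ℝ),
      G.IsSplitting H ∧ H.IsNondegenerate c' ∧ IsSignedQuotient G H c c' φ s := by
  induction hn : G.vertexSet.ncard using Nat.strong_induction_on generalizing G with
  | _ n ih =>
    by_cases hc : G.IsNondegenerate c
    · exact ⟨G, c, id, 1, .refl, hc, .refl G c⟩
    obtain ⟨H, c', φ, s, hGH, hq, hlt⟩ := exists_isSplitting_ncard_lt hc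
    obtain ⟨K, c'', φ', s', hHK, hc'', hq'⟩ := ih _ (hn ▸ hlt) H c' rfl
    exact ⟨K, c'', _, _, hGH.trans hHK, hc'', hq.trans hq'⟩

end Splitting

end SignedGraph

open SignedGraph in
theorem lemma6p3 {α β : Type*} [Fintype α] [Fintype β] (G : SignedGraph α β) :
    ∃ m : ℕ∞,
      IsGreatest {d : ℕ∞ | ∃ H : SignedGraph α β, G.IsSplitting H ∧ d = H.sdNondeg + 1} m ∧
      G.sd ≤ m := by
  obtain ⟨H₀, hH₀, hmax⟩ := Set.exists_max_image {H | G.IsSplitting H}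
    (fun H => H.sdNondeg + 1) (Set.toFinite _) ⟨G, .refl⟩
  refine ⟨H₀.sdNondeg + 1, ⟨⟨H₀, hH₀, rfl⟩, ?_⟩, iSup₂_le fun c hc => ?_⟩
  · rintro _ ⟨H, hH, rfl⟩
    exact hmax H hH
  · obtain ⟨H, c', _, _, hH, hc', hq⟩ := G.exists_isSplitting_isNondegenerate c
    calc G.sdAt c ≤ H.sdAt c' + 1 := hq.sdAt_le hc hc'
      _ ≤ H.sdNondeg + 1 := by
        gcongr
        exact le_iSup₂ (f := fun c _ => H.sdAt c) c' ⟨hq.mem_feasibleWeights hc, hc'⟩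
      _ ≤ H₀.sdNondeg + 1 := hmax H hH
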